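/- Let $J_n(\theta)$, $n\ge 1$, be the Mallows–Riordan polynomials, that is, the polynomials in $\mathbb{Z}[\theta]$ defined by the identity of formal power series $$\log\Big(\sum_{n\ge 0}\theta^{n(n-1)/2}\,\frac{z^n}{n!}\Big)=\sum_{n\ge 1}(\theta-1)^{n-1}J_n(\theta)\,\frac{z^n}{n!}.$$ Define $\widehat J_{n+1}(\theta)$, $n\ge 0$, by the identity of formal power series $$\sum_{n\ge 0}\widehat J_{n+1}(\theta)\,\frac{z^n}{n!}=\frac{1}{1-2z}\Big(\sum_{n\ge 0}J_{n+1}(\theta)\,\frac{z^n}{n!}\Big)^{-1}.$$ Then all $\widehat J_{n+1}$ are polynomials with integer coefficients, $\widehat J_1=1$, and for every $n\ge 1$ the polynomial $\widehat J_{n+1}$ has degree $n(n-1)/2$, its coefficient of order $0$ is $2^{n-1}n!$, and its coefficients of order $1,\dots,n(n-1)/2$ are all strictly negative. Moreover, let $\theta\ge 2$ be real, let $X_1,X_2,\dots$ be independent random variables, each uniformly distributed on $[-1,1]$, and put $Y_0=0$, $Y_n=\theta Y_{n-1}+X_n$ for $n\ge 1$. Then the persistence probabilities $p_n^U(\theta)=\mathbb{P}[Y_1\ge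 0,\dots,Y_n\ge 0]$ (with $p_0^U(\theta)=1$) satisfy $$p_n^U(\theta)=\frac{\widehat J_{n+1}(1/\theta)}{2^n\,n!}\qquad\text{for all } n\ge 0.$$ -/

import Mathlib

open MeasureTheory ProbabilityTheory
open scoped Polynomial PowerSeries Nat

noncomputable section

/-- The field of rational functions `ℚ(θ)`; its indeterminate `θ` is `RatFunc.X`. -/
abbrev RatFun : Type := RatFunc ℚ

/-- An integer polynomial as an element of `ℚ(θ)`. -/
def toRatFun (p : ℤ[X]) : RatFun :=
  algebraMap ℚ[X] RatFun (p.map (Int.castRingHom ℚ))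

/-- The exponential generating function `∑_{n ≥ 0} a n * z ^ n / n!` in `ℚ(θ)⟦z⟧`. -/
def egf (a : ℕ → RatFun) : RatFun⟦X⟧ :=
  PowerSeries.mk fun n => a n / (n ! : RatFun)

/-- The deformed exponential series `∑_{n ≥ 0} θ ^ (n (n - 1) / 2) * z ^ n / n!`. -/
def deformedExp : RatFun⟦X⟧ :=
  egf fun n => RatFunc.X ^ (n * (n - 1) / 2)

/-- The formal logarithm of a power series `F` with constant term `1`, that is, the series
`log (1 + u)` composed with `u = F - 1`. -/
def formalLog (F : RatFun⟦X⟧) : RatFun⟦X⟧ :=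
  (PowerSeries.log RatFun).subst (F - 1)

/-- The Mallows-Riordan polynomials `J n`, `n ≥ 1` (as elements of `ℚ(θ)`), given by
`log (∑_{n ≥ 0} θ ^ (n (n - 1) / 2) z ^ n / n!) = ∑_{n ≥ 1} (θ - 1) ^ (n - 1) J_n(θ) z ^ n / n!`.
Only the values at `n ≥ 1` are meaningful. -/
def mallowsRiordan (n : ℕ) : RatFun :=
  (n ! : RatFun) * PowerSeries.coeff n (formalLog deformedExp) / (RatFunc.X - 1) ^ (n - 1)

/-- The autoregressive sequence `Y 0 = 0`, `Y (n + 1) = θ * Y n + X_{n + 1}`.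
The innovations `X_1, X_2, …` are listed from index zero: `X n` is the innovation `X_{n + 1}`. -/
def arOne {Ω : Type*} (θ : ℝ) (X : ℕ → Ω → ℝ) : ℕ → Ω → ℝ
  | 0, _ => 0
  | n + 1, ω => θ * arOne θ X n ω + X n ω

/-- The persistence probability `P (Y 1 ≥ 0, …, Y n ≥ 0)`. -/
def persistenceProb {Ω : Type*} [MeasurableSpace Ω] (P : Measure Ω) (θ : ℝ)
    (X : ℕ → Ω → ℝ) (n : ℕ) : ℝ :=
  P.real {ω | ∀ k ∈ Finset.Icc 1 n, 0 ≤ arOne θ X k ω}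

end

/-! Both halves of the theorem reduce to one family of polynomials `c_n` (`primeParkingPoly`) with
nonnegative coefficients. Let `E` be the deformed exponential, so that `E'(z) = E(θz)`. Then the
series of the `J_{n+1}`, rescaled by `θ - 1`, is `(log E)' = E(θz)/E(z)`. The inverse quotient
`E(z)/E(θz)` satisfies a functional differential equation whose coefficients reproduce the recursion
of `c_n`, so the inverse of the series of the `J_{n+1}` is `1 - ∑ c_n z^n/n!`
(`egf_mallowsRiordan_mul`). Multiplying by `1/(1 - 2z)` gives `Ĵ_{n+1} = 2n Ĵ_n - c_n` for `n ≥ 1`,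
from which integrality, degree and signs follow.

On the probabilistic side, `p_n - p_{n+1}` is the probability of first becoming negative at time `n
+ 1`. For `θ ≥ 2` a path above 1 never returns below 1, so only the density on `[-1, 1]` matters,
and it is an iterated integral. With `q = 1/θ` this integral has a closed form in terms of `E`, and
its mass on `[-1, 0]` is again `c_{n+1}(q)`, up to normalisation (`integral_crossingDensity`). So
both sides satisfy the same recursion in `n`. -/

noncomputable section

open Finset

/-- The polynomials enumerating prime parking functions of length `n` by their deficit
`n (n + 1) / 2 - ∑ i, a i`, given by their quadratic recursion. -/
def primeParkingPoly : ℕ → ℤ[X]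
  | 0 => 0
  | 1 => 1
  | n + 2 => (∑ i ∈ range n, Polynomial.X ^ (i + 1)) * primeParkingPoly (n + 1) +
      ∑ k : Fin (n + 1), ((n + 1).choose (k + 1) : ℤ[X]) * Polynomial.X ^ (k + 1 : ℕ) *
        primeParkingPoly (k + 1) * primeParkingPoly (n + 1 - k)

theorem primeParkingPoly_zero : primeParkingPoly 0 = 0 := by
  rw [primeParkingPoly]

theorem primeParkingPoly_one : primeParkingPoly 1 = 1 := by
  rw [primeParkingPoly]

theorem primeParkingPoly_add_two (n : ℕ) :
    primeParkingPoly (n + 2) =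
      (∑ i ∈ range n, Polynomial.X ^ (i + 1)) * primeParkingPoly (n + 1) +
      ∑ k ∈ range (n + 1), ((n + 1).choose (k + 1) : ℤ[X]) * Polynomial.X ^ (k + 1) *
        primeParkingPoly (k + 1) * primeParkingPoly (n + 1 - k) := by
  rw [primeParkingPoly, Finset.sum_range (n := n + 1)]

/-! ### The quotient E(z)/E(qz) as a generating function -/

section Series

variable {K : Type*} [Field K]

/-- The deformed exponential series at an element `q` of a field. -/
def qExp (q : K) : K⟦X⟧ :=
  PowerSeries.mk fun n => q ^ (n * (n - 1) / 2) / (n ! : K)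

/-- The exponential generating function of the prime parking polynomials at `q`. -/
def primeParkingSeries (q : K) : K⟦X⟧ :=
  PowerSeries.mk fun n => Polynomial.aeval q (primeParkingPoly n) / (n ! : K)

theorem triangle_succ (n : ℕ) : (n + 1) * (n + 1 - 1) / 2 = n * (n - 1) / 2 + n := by
  have h := Finset.sum_range_id_mul_two (n + 1)
  have h' := Finset.sum_range_id_mul_two n
  rw [Finset.sum_range_succ] at h
  omega

theorem constantCoeff_qExp (q : K) : PowerSeries.constantCoeff (qExp q) = 1 := by
  rw [← PowerSeries.coeff_zero_eq_constantCoeff_apply]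
  simp [qExp]

theorem constantCoeff_rescale_qExp (a q : K) :
    PowerSeries.constantCoeff (PowerSeries.rescale a (qExp q)) = 1 := by
  rw [← PowerSeries.coeff_zero_eq_constantCoeff_apply, PowerSeries.coeff_rescale]
  simp [qExp]

theorem derivative_rescale (a : K) (f : K⟦X⟧) :
    PowerSeries.derivative K (PowerSeries.rescale a f) =
      PowerSeries.C a * PowerSeries.rescale a (PowerSeries.derivative K f) := by
  ext n
  simp [PowerSeries.coeff_derivative, PowerSeries.coeff_rescale, pow_succ]
  ring

variable [CharZero K]

theorem derivative_qExp (q : K) :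
    PowerSeries.derivative K (qExp q) = PowerSeries.rescale q (qExp q) := by
  ext n
  have h1 : (n ! : K) ≠ 0 := by exact_mod_cast n.factorial_ne_zero
  have h2 : (n : K) + 1 ≠ 0 := by exact_mod_cast n.succ_ne_zero
  rw [PowerSeries.coeff_derivative, PowerSeries.coeff_rescale, qExp, PowerSeries.coeff_mk,
    PowerSeries.coeff_mk, triangle_succ, Nat.factorial_succ]
  push_cast
  field_simp
  ring

/-- The functional differential equation of the quotient `E(z) / E(q z)`. -/
theorem qExp_quotient_ode (q : K) {L : K⟦X⟧} (hL : L * PowerSeries.rescale q (qExp q) = qExp q) :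
    PowerSeries.derivative K L * PowerSeries.rescale q L + PowerSeries.C q * L =
      PowerSeries.rescale q L := by
  set M := PowerSeries.rescale q (qExp q) with hM
  have hM0 : M ≠ 0 := fun h => by
    have := constantCoeff_rescale_qExp q q
    rw [← hM, h] at this
    simp at this
  have h1 := congrArg (PowerSeries.derivative K) hL
  rw [derivative_qExp, ← hM, Derivation.leibniz, hM, derivative_rescale, derivative_qExp, ← hM]
    at h1
  simp only [smul_eq_mul] at h1
  have h2 := congrArg (PowerSeries.rescale q) hL
  rw [map_mul, ← hM] at h2
  -- Combining the derivative of `L(z) E(qz) = E(z)` with the same identity at `qz` eliminates `E`,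
  -- up to the nonzero factor `E(qz)`.
  apply mul_right_cancel₀ hM0
  linear_combination PowerSeries.rescale q L * h1 - L * PowerSeries.C q * h2

/-- Comparing coefficients in the differential equation for `D = 1 - L` yields the recursion of the
prime parking polynomials. No division by `q - 1` occurs, so `q = 1` is allowed. -/
theorem coeff_qExp_quotient (q : K) {L : K⟦X⟧}
    (hL : L * PowerSeries.rescale q (qExp q) = qExp q) (n : ℕ) :
    PowerSeries.coeff n (1 - L) =
      (q - 1) ^ n * (Polynomial.aeval q (primeParkingPoly n) / (n ! : K)) := by
  have hode := qExp_quotient_ode q hL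
  obtain ⟨D, hD⟩ : ∃ D, D = 1 - L := ⟨_, rfl⟩
  obtain rfl : L = 1 - D := by rw [hD]; ring
  have hD0 : PowerSeries.coeff 0 D = 0 := by
    have := congrArg (PowerSeries.constantCoeff) hL
    rw [map_mul, constantCoeff_rescale_qExp, constantCoeff_qExp, map_sub] at this
    simp at this
    simpa using this
  have hD0' : PowerSeries.coeff 0 (PowerSeries.rescale q D) = 0 := by
    rw [PowerSeries.coeff_rescale, hD0, mul_zero]
  have hD' : PowerSeries.derivative K D = PowerSeries.rescale q D * PowerSeries.derivative K D +
      PowerSeries.C (q - 1) - PowerSeries.C q * D + PowerSeries.rescale q D := by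
    rw [map_sub, map_sub, Derivation.map_one_eq_zero, map_one] at hode
    rw [map_sub, map_one]
    linear_combination -hode
  rw [sub_sub_cancel]
  induction n using Nat.strong_induction_on with
  | _ n ih =>
  match n with
  | 0 => simp [hD0, primeParkingPoly_zero]
  | 1 =>
    have h := congrArg (PowerSeries.coeff 0) hD'
    rw [PowerSeries.coeff_zero_eq_constantCoeff_apply] at hD0 hD0'
    simp only [PowerSeries.coeff_derivative, PowerSeries.coeff_zero_eq_constantCoeff_apply,
      map_add, map_sub, map_mul, hD0, hD0', PowerSeries.constantCoeff_C] at h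
    simpa [primeParkingPoly_one] using h
  | n + 2 =>
    have h := congrArg (PowerSeries.coeff (n + 1)) hD'
    rw [map_add, map_sub, map_add, PowerSeries.coeff_mul,
      Finset.Nat.sum_antidiagonal_eq_sum_range_succ (fun i j => PowerSeries.coeff i
        (PowerSeries.rescale q D) * PowerSeries.coeff j (PowerSeries.derivative K D)),
      Finset.sum_range_succ', hD0', zero_mul, add_zero,
      PowerSeries.coeff_C, if_neg (Nat.succ_ne_zero n), PowerSeries.coeff_C_mul,
      PowerSeries.coeff_rescale, PowerSeries.coeff_derivative, ih (n + 1) (by omega)] at h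
    have hn1 : ((n + 1) ! : K) ≠ 0 := by exact_mod_cast (n + 1).factorial_ne_zero
    have hn2 : (n : K) + 2 ≠ 0 := by exact_mod_cast (n + 1).succ_ne_zero
    have hsum : ∑ k ∈ range (n + 1), PowerSeries.coeff (k + 1) (PowerSeries.rescale q D) *
        PowerSeries.coeff (n + 1 - (k + 1)) (PowerSeries.derivative K D) =
        (q - 1) ^ (n + 2) / ((n + 1) ! : K) * ∑ k ∈ range (n + 1),
          ((n + 1).choose (k + 1) : K) * q ^ (k + 1) *
            Polynomial.aeval q (primeParkingPoly (k + 1)) *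
            Polynomial.aeval q (primeParkingPoly (n + 1 - k)) := by
      rw [Finset.mul_sum]
      refine Finset.sum_congr rfl fun k hk => ?_
      obtain ⟨m, rfl⟩ : ∃ m, n = k + m := ⟨n - k, by have := Finset.mem_range.1 hk; omega⟩
      have e1 : k + m + 1 - (k + 1) = m := by omega
      have e2 : k + m + 1 - k = m + 1 := by omega
      rw [e1, e2, PowerSeries.coeff_rescale, PowerSeries.coeff_derivative, ih _ (by omega),
        ih _ (by omega)]
      have hc : ((k + m + 1).choose (k + 1) : K) * ((k + 1) ! : K) * (m ! : K) =
          ((k + m + 1) ! : K) := by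
        have := Nat.choose_mul_factorial_mul_factorial (n := k + m + 1) (k := k + 1) (by omega)
        rw [e1] at this
        exact_mod_cast this
      have hk1 : ((k + 1) ! : K) ≠ 0 := by exact_mod_cast (k + 1).factorial_ne_zero
      have hm0 : (m ! : K) ≠ 0 := by exact_mod_cast m.factorial_ne_zero
      have hm1 : (m : K) + 1 ≠ 0 := by exact_mod_cast m.succ_ne_zero
      rw [Nat.factorial_succ m]
      push_cast
      field_simp
      rw [← hc]
      ring
    rw [hsum] at h
    -- The linear terms carry only `(q - 1)^(n + 1)`; the geometric sum supplies the missing factor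
    -- `q - 1`.
    have hgeom : (q - 1) * ∑ i ∈ range n, q ^ (i + 1) = q ^ (n + 1) - q := by
      have := mul_geom_sum q n
      simp only [pow_succ]
      rw [← Finset.sum_mul, ← mul_assoc, this]
      ring
    rw [primeParkingPoly_add_two]
    simp only [map_add, map_mul, map_sum, map_pow, Polynomial.aeval_X, map_natCast]
    set S := ∑ k ∈ range (n + 1), ((n + 1).choose (k + 1) : K) * q ^ (k + 1) *
      Polynomial.aeval q (primeParkingPoly (k + 1)) *
      Polynomial.aeval q (primeParkingPoly (n + 1 - k))
    set T := ∑ i ∈ range n, q ^ (i + 1)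
    rw [Nat.factorial_succ (n + 1)]
    push_cast at h ⊢
    have h' : PowerSeries.coeff (n + 2) D * ((n : K) + 2) =
        (q - 1) ^ (n + 1) * (((q ^ (n + 1) - q) * Polynomial.aeval q (primeParkingPoly (n + 1)) +
          (q - 1) * S) / ((n + 1) ! : K)) := by
      rw [show (n : K) + 2 = n + 1 + 1 by ring, h]
      ring
    rw [← hgeom] at h'
    rw [eq_div_of_mul_eq hn2 h', show (n : K) + 1 + 1 = n + 2 by ring]
    field_simp
    ring

theorem rescale_one_sub_primeParkingSeries (q : K) :
    PowerSeries.rescale (q - 1) (1 - primeParkingSeries q) * PowerSeries.rescale q (qExp q) =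
      qExp q := by
  have hu : PowerSeries.constantCoeff (PowerSeries.rescale q (qExp q)) ≠ 0 := by
    rw [constantCoeff_rescale_qExp]; exact one_ne_zero
  have hL : (qExp q * (PowerSeries.rescale q (qExp q))⁻¹) * PowerSeries.rescale q (qExp q) =
      qExp q := by
    rw [mul_assoc, PowerSeries.inv_mul_cancel _ hu, mul_one]
  have hd : PowerSeries.rescale (q - 1) (primeParkingSeries q) =
      1 - qExp q * (PowerSeries.rescale q (qExp q))⁻¹ := by
    ext n
    rw [coeff_qExp_quotient q hL, PowerSeries.coeff_rescale, primeParkingSeries,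
      PowerSeries.coeff_mk]
  rw [map_sub, map_one, hd, sub_sub_cancel, hL]

end Series

/-! ### Signs and degrees of the coefficients -/

theorem coeff_geom_mul (n k : ℕ) (p : ℤ[X]) :
    ((∑ i ∈ range n, Polynomial.X ^ (i + 1)) * p).coeff k =
      ∑ i ∈ range n, if i + 1 ≤ k then p.coeff (k - (i + 1)) else 0 := by
  rw [Finset.sum_mul, Polynomial.finsetSum_coeff]
  exact Finset.sum_congr rfl fun i _ => Polynomial.coeff_X_pow_mul' p _ _

theorem coeff_mul_nonneg {p r : ℤ[X]} (hp : ∀ k, 0 ≤ p.coeff k) (hr : ∀ k, 0 ≤ r.coeff k) (k : ℕ) :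
    0 ≤ (p * r).coeff k := by
  rw [Polynomial.coeff_mul]
  exact Finset.sum_nonneg fun _ _ => mul_nonneg (hp _) (hr _)

theorem primeParkingPoly_coeff_nonneg (n k : ℕ) : 0 ≤ (primeParkingPoly n).coeff k := by
  induction n using Nat.strong_induction_on generalizing k with
  | _ n ih =>
  match n with
  | 0 => simp [primeParkingPoly_zero]
  | 1 => rw [primeParkingPoly_one, Polynomial.coeff_one]; split_ifs <;> simp
  | n + 2 =>
    rw [primeParkingPoly_add_two, Polynomial.coeff_add, coeff_geom_mul, Polynomial.finsetSum_coeff]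
    refine add_nonneg (Finset.sum_nonneg fun i _ => ?_) (Finset.sum_nonneg fun i hi => ?_)
    · split_ifs
      · exact ih _ (by omega) _
      · exact le_rfl
    · have := Finset.mem_range.1 hi
      refine coeff_mul_nonneg (coeff_mul_nonneg (fun j => ?_) (ih _ (by omega)))
        (ih _ (by omega)) k
      rw [← Polynomial.C_eq_natCast, Polynomial.coeff_C_mul_X_pow]
      split_ifs <;> simp

/-- The recursion dominates coefficientwise `(θ + ⋯ + θ ^ (n + 1)) c_{n + 1}`. -/
theorem primeParkingPoly_coeff_ge (n k i : ℕ) (hi : i ≤ n) (hk : i + 1 ≤ k) :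
    (primeParkingPoly (n + 1)).coeff (k - (i + 1)) ≤ (primeParkingPoly (n + 2)).coeff k := by
  have hsecond : ∀ j ∈ range (n + 1), 0 ≤ (((n + 1).choose (j + 1) : ℤ[X]) *
      Polynomial.X ^ (j + 1) * primeParkingPoly (j + 1) * primeParkingPoly (n + 1 - j)).coeff k := by
    intro j _
    refine coeff_mul_nonneg (coeff_mul_nonneg (fun l => ?_) (primeParkingPoly_coeff_nonneg _))
      (primeParkingPoly_coeff_nonneg _) k
    rw [← Polynomial.C_eq_natCast, Polynomial.coeff_C_mul_X_pow]
    split_ifs <;> simp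
  have hfirst : ∀ j ∈ range n, 0 ≤
      if j + 1 ≤ k then (primeParkingPoly (n + 1)).coeff (k - (j + 1)) else 0 := by
    intro j _
    split_ifs
    · exact primeParkingPoly_coeff_nonneg _ _
    · exact le_rfl
  rw [primeParkingPoly_add_two, Polynomial.coeff_add, coeff_geom_mul, Polynomial.finsetSum_coeff]
  rcases hi.lt_or_eq with hi | rfl
  · refine le_add_of_le_of_nonneg ?_ (Finset.sum_nonneg hsecond)
    refine le_trans ?_ (Finset.single_le_sum hfirst (Finset.mem_range.2 hi))
    rw [if_pos hk]
  -- The top shift is absent from the geometric sum; the last term of the convolution provides it,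
  -- its binomial coefficient and its factor `c_1` being 1.
  · refine le_add_of_nonneg_of_le (Finset.sum_nonneg hfirst) ?_
    refine le_trans ?_ (Finset.single_le_sum hsecond (Finset.self_mem_range_succ i))
    rw [Nat.choose_self, Nat.cast_one, one_mul, Nat.add_sub_cancel_left, primeParkingPoly_one,
      mul_one, Polynomial.coeff_X_pow_mul', if_pos hk]

theorem primeParkingPoly_coeff_pos (n k : ℕ) (h1 : n ≤ k) (h2 : k ≤ (n + 1) * (n + 1 - 1) / 2) :
    0 < (primeParkingPoly (n + 1)).coeff k := by
  induction n generalizing k with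
  | zero =>
    obtain rfl : k = 0 := by simpa using h2
    simp [primeParkingPoly_one]
  | succ n ih =>
    rw [triangle_succ] at h2
    -- The order `k` is reached by a shift from the previous range of positivity: from its lower end
    -- `n` when `k` is small, and by the largest shift otherwise.
    obtain ⟨i, hi, hk, h3, h4⟩ : ∃ i, i ≤ n ∧ i + 1 ≤ k ∧ n ≤ k - (i + 1) ∧
        k - (i + 1) ≤ (n + 1) * (n + 1 - 1) / 2 := by
      have := triangle_succ n
      rcases le_total k (n + 1 + n) with h | h
      · refine ⟨k - (n + 1), by omega, by omega, by omega, ?_⟩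
        rcases n with _ | n
        · omega
        · have := triangle_succ n
          omega
      · exact ⟨n, le_rfl, by omega, by omega, by omega⟩
    exact (ih _ h3 h4).trans_le (primeParkingPoly_coeff_ge n k i hi hk)

theorem primeParkingPoly_natDegree_le (n : ℕ) :
    (primeParkingPoly n).natDegree ≤ n * (n - 1) / 2 := by
  induction n using Nat.strong_induction_on with
  | _ n ih =>
  match n with
  | 0 => simp [primeParkingPoly_zero]
  | 1 => simp [primeParkingPoly_one]
  | n + 2 =>
    rw [primeParkingPoly_add_two, triangle_succ]
    have hgeom : (∑ i ∈ range n, (Polynomial.X : ℤ[X]) ^ (i + 1)).natDegree ≤ n + 1 :=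
      Polynomial.natDegree_sum_le_of_forall_le _ _ fun k hk => by
        have := Finset.mem_range.1 hk
        rw [Polynomial.natDegree_X_pow]
        omega
    refine Polynomial.natDegree_add_le_of_degree_le ?_
      (Polynomial.natDegree_sum_le_of_forall_le _ _ fun k hk => ?_)
    · exact (Polynomial.natDegree_mul_le_of_le hgeom (ih _ (by omega))).trans
        (add_comm _ _).le
    · obtain ⟨m, rfl⟩ : ∃ m, n = k + m := ⟨n - k, by have := Finset.mem_range.1 hk; omega⟩
      have e : k + m + 1 - k = m + 1 := by omega
      have h1 := ih (k + 1) (by omega)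
      have h2 := ih (m + 1) (by omega)
      have h0 : (((k + m + 1).choose (k + 1) : ℤ[X]) * Polynomial.X ^ (k + 1)).natDegree ≤ k + 1 := by
        rw [← Polynomial.C_eq_natCast]
        exact Polynomial.natDegree_C_mul_X_pow_le _ _
      rw [e]
      refine (Polynomial.natDegree_mul_le_of_le (Polynomial.natDegree_mul_le_of_le h0 h1) h2).trans ?_
      simp only [Nat.add_sub_cancel]
      have t1 : (k + 1) * k / 2 * 2 = (k + 1) * k := Nat.div_mul_cancel (by
        rw [mul_comm]; exact (Nat.even_mul_succ_self k).two_dvd)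
      have t2 : (m + 1) * m / 2 * 2 = (m + 1) * m := Nat.div_mul_cancel (by
        rw [mul_comm]; exact (Nat.even_mul_succ_self m).two_dvd)
      have t3 : (k + m + 1) * (k + m) / 2 * 2 = (k + m + 1) * (k + m) := Nat.div_mul_cancel (by
        rw [mul_comm]; exact (Nat.even_mul_succ_self (k + m)).two_dvd)
      nlinarith

/-- The polynomials `Ĵ_{n + 1}`, indexed by `n`. -/
def persistencePoly : ℕ → ℤ[X]
  | 0 => 1
  | n + 1 => Polynomial.C (2 * (n + 1 : ℤ)) * persistencePoly n - primeParkingPoly (n + 1)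

theorem persistencePoly_natDegree_le (n : ℕ) :
    (persistencePoly n).natDegree ≤ n * (n - 1) / 2 := by
  induction n with
  | zero => simp [persistencePoly]
  | succ n ih =>
    rw [persistencePoly]
    have h1 := primeParkingPoly_natDegree_le (n + 1)
    have h2 := Polynomial.natDegree_C_mul_le (2 * (n + 1 : ℤ)) (persistencePoly n)
    refine (Polynomial.natDegree_sub_le_of_le h2 h1).trans (max_le (ih.trans ?_) le_rfl)
    rw [triangle_succ]
    exact Nat.le_add_right _ _

theorem persistencePoly_coeff_zero (n : ℕ) :
    (persistencePoly (n + 1)).coeff 0 = 2 ^ n * ((n + 1) ! : ℤ) := by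
  induction n with
  | zero => simp [persistencePoly, primeParkingPoly_one]
  | succ n ih =>
    have h0 : (primeParkingPoly (n + 2)).coeff 0 = 0 := by
      simp [primeParkingPoly_add_two, Polynomial.coeff_zero_eq_eval_zero, Polynomial.eval_finsetSum]
    rw [persistencePoly, Polynomial.coeff_sub, Polynomial.coeff_C_mul, ih, h0,
      Nat.factorial_succ (n + 1)]
    push_cast
    ring

/-- Old negative coefficients stay negative, since something nonnegative is subtracted from a
positive multiple. Orders above the previous degree come from `-c_n` alone, and lie where `c_n` has
positive coefficients. -/
theorem persistencePoly_coeff_neg (n k : ℕ) (h1 : 1 ≤ k) (h2 : k ≤ (n + 1) * (n + 1 - 1) / 2) :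
    (persistencePoly (n + 1)).coeff k < 0 := by
  induction n with
  | zero => simp at h2; omega
  | succ n ih =>
    rw [persistencePoly, Polynomial.coeff_sub, Polynomial.coeff_C_mul]
    rcases le_or_gt k ((n + 1) * (n + 1 - 1) / 2) with h | h
    · have h3 := primeParkingPoly_coeff_nonneg (n + 2) k
      have h4 : (2 * ((n + 1 : ℕ) + 1 : ℤ)) * (persistencePoly (n + 1)).coeff k < 0 :=
        mul_neg_of_pos_of_neg (by positivity) (ih h)
      exact sub_neg.2 (h4.trans_le h3)
    · rw [Polynomial.coeff_eq_zero_of_natDegree_lt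
        ((persistencePoly_natDegree_le (n + 1)).trans_lt h), mul_zero, zero_sub, neg_neg_iff_pos]
      refine primeParkingPoly_coeff_pos (n + 1) k ?_ h2
      have := triangle_succ n
      rcases n with _ | n
      · omega
      · have := triangle_succ n
        rcases n with _ | n
        · omega
        · have := triangle_succ n
          omega

theorem persistencePoly_natDegree (n : ℕ) :
    (persistencePoly n).natDegree = n * (n - 1) / 2 := by
  refine le_antisymm (persistencePoly_natDegree_le n) (Polynomial.le_natDegree_of_ne_zero ?_)
  rcases n with _ | n
  · simp [persistencePoly]
  · rcases Nat.eq_zero_or_pos ((n + 1) * (n + 1 - 1) / 2) with h | h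
    · rw [h, persistencePoly_coeff_zero]
      positivity
    · exact (persistencePoly_coeff_neg n _ h le_rfl).ne

/-! ### Formal logarithm and Mallows–Riordan polynomials -/

theorem toRatFun_eq_aeval (p : ℤ[X]) : toRatFun p = Polynomial.aeval (RatFunc.X : RatFun) p := by
  rw [toRatFun, ← RatFunc.algebraMap_X, Polynomial.aeval_algebraMap_apply,
    ← Polynomial.aeval_map_algebraMap ℚ, Polynomial.aeval_X_left_apply]
  rfl

theorem derivative_formalLog {F : RatFun⟦X⟧} (hF : PowerSeries.constantCoeff F = 1) :
    PowerSeries.derivative RatFun (formalLog F) = PowerSeries.derivative RatFun F * F⁻¹ := by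
  have hs : PowerSeries.HasSubst (F - 1) :=
    PowerSeries.HasSubst.of_constantCoeff_zero' (by rw [map_sub, hF, map_one, sub_self])
  have hgeom : (1 + PowerSeries.X) * PowerSeries.derivative RatFun (PowerSeries.log RatFun) = 1 := by
    rw [PowerSeries.deriv_log, add_mul, one_mul]
    ext n
    rcases n with _ | n
    · simp
    · rw [map_add, PowerSeries.coeff_succ_X_mul]
      simp [PowerSeries.coeff_one, pow_succ]
  have h := congrArg (PowerSeries.substAlgHom hs) hgeom
  rw [map_mul, map_add, map_one, PowerSeries.substAlgHom_X, add_sub_cancel,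
    PowerSeries.coe_substAlgHom] at h
  have hinv : (PowerSeries.derivative RatFun (PowerSeries.log RatFun)).subst (F - 1) = F⁻¹ :=
    (PowerSeries.eq_inv_iff_mul_eq_one (by rw [hF]; exact one_ne_zero)).2 ((mul_comm _ _).trans h)
  rw [formalLog, PowerSeries.derivative_subst hs, map_sub, Derivation.map_one_eq_zero, sub_zero,
    mul_comm, hinv]

theorem deformedExp_eq : deformedExp = qExp (RatFunc.X : RatFun) := rfl

theorem ratFunc_X_sub_one_ne_zero : (RatFunc.X : RatFun) - 1 ≠ 0 := by
  rw [← RatFunc.algebraMap_X, ← map_one (algebraMap ℚ[X] RatFun), ← map_sub]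
  exact (map_ne_zero_iff _ (RatFunc.algebraMap_injective ℚ)).2 (Polynomial.X_sub_C_ne_zero 1)

theorem rescale_egf_mallowsRiordan :
    PowerSeries.rescale (RatFunc.X - 1) (egf fun n => mallowsRiordan (n + 1)) =
      PowerSeries.derivative RatFun (formalLog deformedExp) := by
  ext n
  have h1 : (n ! : RatFun) ≠ 0 := by exact_mod_cast n.factorial_ne_zero
  have h2 := pow_ne_zero n ratFunc_X_sub_one_ne_zero
  rw [PowerSeries.coeff_rescale, egf, PowerSeries.coeff_mk, PowerSeries.coeff_derivative,
    mallowsRiordan, Nat.add_sub_cancel, Nat.factorial_succ]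
  push_cast
  field_simp

/-- Rescaled by `θ - 1`, the two factors become `E(θz)/E(z)` and `E(z)/E(θz)`; rescaling by a
nonzero element is injective. -/
theorem egf_mallowsRiordan_mul :
    (egf fun n => mallowsRiordan (n + 1)) * (1 - primeParkingSeries (RatFunc.X : RatFun)) = 1 := by
  have hE : PowerSeries.constantCoeff (qExp (RatFunc.X : RatFun)) = 1 := constantCoeff_qExp _
  have h : PowerSeries.rescale (RatFunc.X - 1) ((egf fun n => mallowsRiordan (n + 1)) *
      (1 - primeParkingSeries (RatFunc.X : RatFun))) = 1 := by
    have h1 := rescale_one_sub_primeParkingSeries (RatFunc.X : RatFun)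
    rw [map_mul, rescale_egf_mallowsRiordan, deformedExp_eq, derivative_formalLog hE,
      derivative_qExp, mul_right_comm, mul_comm (PowerSeries.rescale _ _), h1,
      PowerSeries.mul_inv_cancel _ (by rw [hE]; exact one_ne_zero)]
  ext n
  have h2 := congrArg (PowerSeries.coeff n) h
  rw [PowerSeries.coeff_rescale] at h2
  apply mul_left_cancel₀ (pow_ne_zero n ratFunc_X_sub_one_ne_zero)
  rw [h2, PowerSeries.coeff_one]
  split_ifs with hn <;> simp [hn]

theorem egf_toRatFun_primeParkingPoly :
    egf (fun n => toRatFun (primeParkingPoly n)) = primeParkingSeries (RatFunc.X : RatFun) := by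
  simp only [egf, primeParkingSeries, toRatFun_eq_aeval]
  congr!
  all_goals exact Subsingleton.elim _ _

/-- Since `c_0 = 0`, only earlier values occur on the right, so integrality propagates by strong
induction. -/
theorem mallowsRiordan_recursion (n : ℕ) :
    mallowsRiordan (n + 1) = (if n = 0 then 1 else 0) + ∑ k ∈ range n,
      (n.choose (k + 1) : RatFun) * toRatFun (primeParkingPoly (k + 1)) *
        mallowsRiordan (n - (k + 1) + 1) := by
  have h : (egf fun n => mallowsRiordan (n + 1)) = 1 +
      egf (fun n => toRatFun (primeParkingPoly n)) * egf fun n => mallowsRiordan (n + 1) := by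
    rw [egf_toRatFun_primeParkingPoly]
    linear_combination egf_mallowsRiordan_mul
  have hn0 : (n ! : RatFun) ≠ 0 := by exact_mod_cast n.factorial_ne_zero
  have h1 := congrArg (fun F => (n ! : RatFun) * PowerSeries.coeff n F) h
  simp only [map_add, PowerSeries.coeff_mul, PowerSeries.coeff_one, mul_add] at h1
  rw [Finset.Nat.sum_antidiagonal_eq_sum_range_succ (fun i j => PowerSeries.coeff i
      (egf fun n => toRatFun (primeParkingPoly n)) * PowerSeries.coeff j
      (egf fun n => mallowsRiordan (n + 1))), Finset.sum_range_succ'] at h1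
  simp only [egf, PowerSeries.coeff_mk, primeParkingPoly_zero, toRatFun, Polynomial.map_zero,
    map_zero, zero_div, zero_mul, add_zero] at h1
  rw [mul_div_cancel₀ _ hn0] at h1
  rw [h1, Finset.mul_sum]
  congr 1
  · split_ifs with hn <;> simp [hn]
  · refine Finset.sum_congr rfl fun k hk => ?_
    have hk' := Finset.mem_range.1 hk
    have hc : (n.choose (k + 1) : RatFun) * ((k + 1) ! : RatFun) * ((n - (k + 1)) ! : RatFun) =
        (n ! : RatFun) := by
      exact_mod_cast Nat.choose_mul_factorial_mul_factorial (n := n) (k := k + 1) (by omega)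
    have hk1 : ((k + 1) ! : RatFun) ≠ 0 := by exact_mod_cast (k + 1).factorial_ne_zero
    have hm1 : ((n - (k + 1)) ! : RatFun) ≠ 0 := by exact_mod_cast Nat.factorial_ne_zero _
    rw [← hc, toRatFun]
    field_simp

theorem exists_toRatFun_eq_mallowsRiordan (n : ℕ) :
    ∃ J : ℤ[X], toRatFun J = mallowsRiordan (n + 1) := by
  induction n using Nat.strong_induction_on with
  | _ n ih =>
  have hmem : ∀ x : RatFun, (∃ J : ℤ[X], toRatFun J = x) ↔
      x ∈ (Polynomial.aeval (R := ℤ) (RatFunc.X : RatFun)).range := fun x => by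
    simp only [toRatFun_eq_aeval, AlgHom.mem_range]
  rw [hmem, mallowsRiordan_recursion]
  refine add_mem ?_ (sum_mem fun k hk => mul_mem (mul_mem (natCast_mem _ _) ?_) ?_)
  · split_ifs
    · exact one_mem _
    · exact zero_mem _
  · exact (hmem _).1 ⟨_, rfl⟩
  · exact (hmem _).1 (ih _ (by have := Finset.mem_range.1 hk; omega))

theorem egf_persistencePoly :
    egf (fun n => toRatFun (persistencePoly n)) =
      (1 - 2 * (PowerSeries.X : RatFun⟦X⟧))⁻¹ * (egf fun n => mallowsRiordan (n + 1))⁻¹ := by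
  have hG := egf_mallowsRiordan_mul
  have hG0 : PowerSeries.constantCoeff (egf fun n => mallowsRiordan (n + 1)) ≠ 0 := fun h => by
    have := congrArg PowerSeries.constantCoeff hG
    rw [map_mul, h] at this
    simp at this
  have hX0 : PowerSeries.constantCoeff (1 - 2 * (PowerSeries.X : RatFun⟦X⟧)) ≠ 0 := by simp
  rw [← (PowerSeries.eq_inv_iff_mul_eq_one hG0).2 ((mul_comm _ _).trans hG), mul_comm,
    PowerSeries.eq_mul_inv_iff_mul_eq hX0, mul_sub, mul_one, mul_left_comm, two_mul,
    ← egf_toRatFun_primeParkingPoly]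
  ext n
  rcases n with _ | n
  · simp [egf, persistencePoly, primeParkingPoly_zero, toRatFun]
  · simp only [map_sub, map_add, PowerSeries.coeff_succ_mul_X, egf, PowerSeries.coeff_mk,
      PowerSeries.coeff_one, persistencePoly, toRatFun_eq_aeval, map_mul, Polynomial.aeval_C]
    have h1 : (n ! : RatFun) ≠ 0 := by exact_mod_cast n.factorial_ne_zero
    have h2 : (n : RatFun) + 1 ≠ 0 := by exact_mod_cast n.succ_ne_zero
    rw [Nat.factorial_succ, if_neg n.succ_ne_zero]
    simp only [map_natCast, map_one, map_ofNat]
    push_cast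
    field_simp
    ring

theorem aeval_persistencePoly_succ (q : ℝ) (n : ℕ) :
    Polynomial.aeval q (persistencePoly (n + 1)) / (2 ^ (n + 1) * ((n + 1) ! : ℝ)) =
      Polynomial.aeval q (persistencePoly n) / (2 ^ n * (n ! : ℝ)) -
        Polynomial.aeval q (primeParkingPoly (n + 1)) / (2 ^ (n + 1) * ((n + 1) ! : ℝ)) := by
  have h : (n ! : ℝ) ≠ 0 := by positivity
  rw [persistencePoly, Nat.factorial_succ]
  simp only [map_sub, map_mul, Polynomial.aeval_C]
  push_cast
  simp only [map_ofNat]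
  field_simp
  ring

/-! ### Crossing densities in closed form -/

/-- Up to the factor `2 ^ (n + 1)`, the density on `[-1, 1]` of the autoregressive sequence with
parameter `1 / q` at time `n + 1`, on the event that it has not been negative before. -/
def crossingDensity (q : ℝ) : ℕ → ℝ → ℝ
  | 0, _ => 1
  | n + 1, y => ∫ t in (0 : ℝ)..q * (1 + y), crossingDensity q n t

theorem continuous_crossingDensity (q : ℝ) (n : ℕ) : Continuous (crossingDensity q n) := by
  induction n with
  | zero => exact continuous_const
  | succ n ih =>
    have h := intervalIntegral.continuous_primitive (μ := volume)
      (fun a b => ih.intervalIntegrable a b) 0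
    exact h.comp (by fun_prop : Continuous fun y : ℝ => q * (1 + y))

theorem crossingDensity_nonneg {q : ℝ} (hq : 0 ≤ q) (n : ℕ) {y : ℝ} (hy : -1 ≤ y) :
    0 ≤ crossingDensity q n y := by
  induction n generalizing y with
  | zero => exact zero_le_one
  | succ n ih =>
    exact intervalIntegral.integral_nonneg (mul_nonneg hq (by linarith))
      fun t ht => ih (by linarith [ht.1])

/-- As `E'(z) = E(qz)`, differentiating `E(xz)` in `x` gives `z E(qxz)`; the factor `z` lowers the
index by one. -/
theorem hasDerivAt_coeff_mul_rescale_qExp (q : ℝ) (A : ℝ⟦X⟧) (n : ℕ) (x : ℝ) :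
    HasDerivAt (fun x => PowerSeries.coeff (n + 1) (A * PowerSeries.rescale x (qExp q)))
      (PowerSeries.coeff n (A * PowerSeries.rescale (q * x) (qExp q))) x := by
  simp only [PowerSeries.coeff_mul, PowerSeries.coeff_rescale,
    Finset.Nat.sum_antidiagonal_eq_sum_range_succ_mk]
  rw [funext fun x => Finset.sum_range_succ _ (n + 1), Nat.sub_self]
  simp only [pow_zero, one_mul]
  refine HasDerivAt.add_const _ (HasDerivAt.fun_sum fun i hi => ?_)
  obtain ⟨m, rfl⟩ : ∃ m, n = i + m := ⟨n - i, by have := Finset.mem_range.1 hi; omega⟩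
  rw [show i + m + 1 - i = m + 1 by omega, Nat.add_sub_cancel_left]
  have h := ((hasDerivAt_pow (m + 1) x).mul_const
    (PowerSeries.coeff (m + 1) (qExp q))).const_mul (PowerSeries.coeff i A)
  refine h.congr_deriv ?_
  have h1 := congrArg (PowerSeries.coeff m) (derivative_qExp q)
  rw [PowerSeries.coeff_derivative, PowerSeries.coeff_rescale] at h1
  rw [mul_pow, Nat.add_sub_cancel]
  push_cast
  linear_combination PowerSeries.coeff i A * x ^ m * h1

theorem integral_coeff_mul_rescale_qExp (q : ℝ) (A : ℝ⟦X⟧) (n : ℕ) (c a b : ℝ) :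
    ∫ t in a..b, PowerSeries.coeff n (A * PowerSeries.rescale (q * (t - c)) (qExp q)) =
      PowerSeries.coeff (n + 1) (A * PowerSeries.rescale (b - c) (qExp q)) -
        PowerSeries.coeff (n + 1) (A * PowerSeries.rescale (a - c) (qExp q)) := by
  have hcont : Continuous fun t : ℝ =>
      PowerSeries.coeff n (A * PowerSeries.rescale (q * (t - c)) (qExp q)) := by
    simp only [PowerSeries.coeff_mul, PowerSeries.coeff_rescale]
    fun_prop
  refine intervalIntegral.integral_eq_sub_of_hasDerivAt (f := fun t =>
    PowerSeries.coeff (n + 1) (A * PowerSeries.rescale (t - c) (qExp q))) (fun t _ => ?_)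
    (hcont.intervalIntegrable _ _)
  exact (hasDerivAt_coeff_mul_rescale_qExp q A n (t - c)).comp_sub_const t c

/-- Centring at `q / (1 - q)`, the fixed point of `y ↦ q (1 + y)`, turns this map into
multiplication by `q`. The prefactor makes the boundary term at `t = 0` a positive-order coefficient
of the series 1, which vanishes. -/
theorem crossingDensity_eq_coeff {q : ℝ} (hq : q ≠ 1) (n : ℕ) (y : ℝ) :
    crossingDensity q n y = PowerSeries.coeff n
      ((PowerSeries.rescale (q / (q - 1)) (qExp q))⁻¹ *
        PowerSeries.rescale (q * (y - q / (1 - q))) (qExp q)) := by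
  have hq1 : 1 - q ≠ 0 := sub_ne_zero.2 hq.symm
  have hq2 : q - 1 ≠ 0 := sub_ne_zero.2 hq
  induction n generalizing y with
  | zero =>
    simp [crossingDensity, constantCoeff_rescale_qExp]
  | succ n ih =>
    rw [crossingDensity, intervalIntegral.integral_congr fun t _ => ih t,
      integral_coeff_mul_rescale_qExp,
      show (0 : ℝ) - q / (1 - q) = q / (q - 1) by field_simp; ring,
      PowerSeries.inv_mul_cancel _ (by rw [constantCoeff_rescale_qExp]; exact one_ne_zero),
      PowerSeries.coeff_one, if_neg n.succ_ne_zero, sub_zero]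
    congr 4
    field_simp
    ring

theorem integral_crossingDensity {q : ℝ} (hq : q ≠ 1) (n : ℕ) :
    ∫ t in (-1 : ℝ)..0, crossingDensity q n t =
      Polynomial.aeval q (primeParkingPoly (n + 1)) / ((n + 1) ! : ℝ) := by
  have hq1 : 1 - q ≠ 0 := sub_ne_zero.2 hq.symm
  have hq2 : q - 1 ≠ 0 := sub_ne_zero.2 hq
  have hE : PowerSeries.constantCoeff (PowerSeries.rescale (q / (q - 1)) (qExp q)) ≠ 0 := by
    rw [constantCoeff_rescale_qExp]; exact one_ne_zero
  have h := congrArg (PowerSeries.rescale (1 / (q - 1)))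
    (rescale_one_sub_primeParkingSeries q)
  rw [map_mul, PowerSeries.rescale_rescale, PowerSeries.rescale_rescale,
    mul_one_div_cancel hq2, PowerSeries.rescale_one, RingHom.id_apply, mul_one_div] at h
  rw [intervalIntegral.integral_congr fun t _ => crossingDensity_eq_coeff hq n t,
    integral_coeff_mul_rescale_qExp,
    show (0 : ℝ) - q / (1 - q) = q / (q - 1) by field_simp; ring,
    show (-1 : ℝ) - q / (1 - q) = 1 / (q - 1) by field_simp; ring,
    PowerSeries.inv_mul_cancel _ hE, ← h, mul_comm (1 - _), ← mul_assoc,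
    PowerSeries.inv_mul_cancel _ hE, one_mul, map_sub, sub_sub_cancel, primeParkingSeries,
    PowerSeries.coeff_mk]

/-! ### Transition densities and persistence probabilities -/

open scoped ENNReal

/-- One step of the autoregression, started from a law with density `d` on `[0, 1]` and killed on
the negative half-line, has an explicit density on `[-1, 1]`. -/
theorem lintegral_uniform_transition {θ : ℝ} (hθ : 2 ≤ θ) {τ : Measure ℝ} [SFinite τ]
    (hτ : ∀ S, MeasurableSet S → τ S = volume (Set.Icc (-1 : ℝ) 1 ∩ S) / 2)
    {ρ : Measure ℝ} {d : ℝ → ℝ≥0∞} (hd : Measurable d)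
    (hρ : ∀ S ⊆ Set.Icc (0 : ℝ) 1, MeasurableSet S → ρ S = ∫⁻ z in S, d z)
    {B : Set ℝ} (hB : MeasurableSet B) (hB1 : B ⊆ Set.Icc (-1) 1) :
    ∫⁻ z, τ {x | 0 ≤ z ∧ θ * z + x ∈ B} ∂ρ =
      ∫⁻ t in B, (∫⁻ z in Set.Icc 0 ((1 + t) / θ), d z) / 2 := by
  have hθ0 : 0 < θ := by linarith
  have hmeas2 : MeasurableSet {p : ℝ × ℝ | 0 ≤ p.1 ∧ θ * p.1 + p.2 ∈ B} :=
    (measurableSet_le measurable_const measurable_fst).inter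
      (((measurable_fst.const_mul θ).add measurable_snd) hB)
  have hmeas : ∀ z : ℝ, MeasurableSet {x : ℝ | 0 ≤ z ∧ θ * z + x ∈ B} := fun z =>
    measurable_prodMk_left hmeas2
  have hmeash : Measurable fun z => τ {x | 0 ≤ z ∧ θ * z + x ∈ B} :=
    measurable_measure_prodMk_left hmeas2
  -- If `z > 1` and `x ≥ -1`, then `θ z + x > 1` because `θ ≥ 2`, so `B` is missed.
  have hsupp : Function.support (fun z => τ {x | 0 ≤ z ∧ θ * z + x ∈ B}) ⊆ Set.Icc 0 1 := by
    intro z hz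
    by_contra hz'
    apply hz
    simp only
    rw [hτ _ (hmeas z), ENNReal.div_eq_zero_iff]
    left
    convert measure_empty (μ := (volume : Measure ℝ))
    refine Set.eq_empty_of_forall_notMem fun x hx => hz' ⟨hx.2.1, ?_⟩
    have h1 := hx.1.1
    have h2 := (hB1 hx.2.2).2
    nlinarith [hx.2.1]
  have hrestr : ρ.restrict (Set.Icc 0 1) = (volume.withDensity d).restrict (Set.Icc 0 1) := by
    refine (Measure.restrict_congr_meas measurableSet_Icc).2 fun S hS hSm => ?_
    rw [hρ S hS hSm, withDensity_apply _ hSm]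
  have hS : ∀ z : ℝ, MeasurableSet {t : ℝ | z ≤ (1 + t) / θ} := fun z =>
    measurableSet_le measurable_const (by fun_prop)
  have hinner : ∀ z ∈ Set.Icc (0 : ℝ) 1, (d * fun z => τ {x | 0 ≤ z ∧ θ * z + x ∈ B}) z =
      ∫⁻ t in B, {t : ℝ | z ≤ (1 + t) / θ}.indicator (fun _ => d z / 2) t := by
    intro z hz
    -- With `t = θ z + x`, the bound `x ≤ 1` is automatic from `t ≤ 1` and `z ≥ 0`; only `x ≥ -1`
    -- constrains `z`.
    have hset : Set.Icc (-1 : ℝ) 1 ∩ {x | 0 ≤ z ∧ θ * z + x ∈ B} =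
        (fun x => θ * z + x) ⁻¹' ({t : ℝ | z ≤ (1 + t) / θ} ∩ B) := by
      ext x
      simp only [Set.mem_inter_iff, Set.mem_Icc, Set.mem_ofPred_eq, Set.mem_preimage,
        le_div_iff₀ hθ0]
      constructor
      · rintro ⟨⟨h1, h2⟩, -, h4⟩
        exact ⟨by linarith, h4⟩
      · rintro ⟨h1, h2⟩
        have h3 := (hB1 h2).2
        have h4 := mul_nonneg hθ0.le hz.1
        exact ⟨⟨by linarith, by linarith⟩, hz.1, h2⟩
    rw [Pi.mul_apply, hτ _ (hmeas z), hset, measure_preimage_add, lintegral_indicator_const (hS z),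
      Measure.restrict_apply (hS z), ENNReal.div_eq_inv_mul, ENNReal.div_eq_inv_mul]
    ring
  have hG : Measurable fun p : ℝ × ℝ =>
      {t : ℝ | p.1 ≤ (1 + t) / θ}.indicator (fun _ => d p.1 / 2) p.2 := by
    have : (fun p : ℝ × ℝ => {t : ℝ | p.1 ≤ (1 + t) / θ}.indicator (fun _ => d p.1 / 2) p.2) =
        {p : ℝ × ℝ | p.1 ≤ (1 + p.2) / θ}.indicator fun p => d p.1 / 2 := by
      ext p
      simp [Set.indicator_apply]
    rw [this]
    exact ((hd.comp measurable_fst).div_const 2).indicator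
      (measurableSet_le measurable_fst (by fun_prop))
  rw [← setLIntegral_eq_of_support_subset hsupp, hrestr,
    setLIntegral_withDensity_eq_setLIntegral_mul _ hd hmeash measurableSet_Icc,
    setLIntegral_congr_fun measurableSet_Icc hinner,
    lintegral_lintegral_swap (f := fun z t =>
      {t : ℝ | z ≤ (1 + t) / θ}.indicator (fun _ => d z / 2) t) hG.aemeasurable]
  refine setLIntegral_congr_fun hB fun t ht => ?_
  have hind : (fun z => {t : ℝ | z ≤ (1 + t) / θ}.indicator (fun _ => d z / 2) t) =
      (Set.Iic ((1 + t) / θ)).indicator fun z => d z / 2 := by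
    ext z
    simp [Set.indicator_apply]
  have hle : (1 + t) / θ ≤ 1 := by
    rw [div_le_one hθ0]
    linarith [(hB1 ht).2]
  have hinter : Set.Iic ((1 + t) / θ) ∩ Set.Icc 0 1 = Set.Icc 0 ((1 + t) / θ) := by
    ext z
    exact ⟨fun h => ⟨h.2.1, h.1⟩, fun h => ⟨h.2, h.1, h.2.trans hle⟩⟩
  rw [hind, lintegral_indicator measurableSet_Iic, Measure.restrict_restrict measurableSet_Iic,
    hinter]
  simp only [ENNReal.div_eq_inv_mul]
  rw [lintegral_const_mul _ hd]

section Autoregression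

variable {Ω : Type*}

/-- The event that the autoregressive sequence is nonnegative up to time `n`. -/
def persistenceEvent (θ : ℝ) (X : ℕ → Ω → ℝ) (n : ℕ) : Set Ω :=
  {ω | ∀ k ∈ Finset.Icc 1 n, 0 ≤ arOne θ X k ω}

theorem persistenceEvent_zero (θ : ℝ) (X : ℕ → Ω → ℝ) : persistenceEvent θ X 0 = Set.univ := by
  simp [persistenceEvent]

theorem persistenceEvent_succ (θ : ℝ) (X : ℕ → Ω → ℝ) (n : ℕ) :
    persistenceEvent θ X (n + 1) = persistenceEvent θ X n ∩ {ω | 0 ≤ arOne θ X (n + 1) ω} := by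
  ext ω
  simp only [persistenceEvent, Set.mem_ofPred_eq, Set.mem_inter_iff, Finset.mem_Icc]
  refine ⟨fun h => ⟨fun k hk => h k ⟨hk.1, by omega⟩, h _ ⟨by omega, le_rfl⟩⟩, ?_⟩
  rintro ⟨h1, h2⟩ k ⟨hk1, hk2⟩
  rcases hk2.lt_or_eq with hk | rfl
  · exact h1 k ⟨hk1, by omega⟩
  · exact h2

theorem arOne_nonneg_of_mem {θ : ℝ} {X : ℕ → Ω → ℝ} {n : ℕ} {ω : Ω}
    (h : ω ∈ persistenceEvent θ X n) : 0 ≤ arOne θ X n ω := by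
  rcases n with _ | n
  · exact le_rfl
  · exact h _ (Finset.mem_Icc.2 ⟨by omega, le_rfl⟩)

/-- The autoregressive sequence, sent to `-1` once it has been negative. -/
def killedArOne (θ : ℝ) (X : ℕ → Ω → ℝ) (n : ℕ) : Ω → ℝ :=
  open Classical in (persistenceEvent θ X n).piecewise (arOne θ X n) fun _ => -1

theorem killedArOne_of_mem {θ : ℝ} {X : ℕ → Ω → ℝ} {n : ℕ} {ω : Ω}
    (h : ω ∈ persistenceEvent θ X n) : killedArOne θ X n ω = arOne θ X n ω := by
  simp [killedArOne, h]

theorem killedArOne_nonneg_iff {θ : ℝ} {X : ℕ → Ω → ℝ} {n : ℕ} {ω : Ω} :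
    0 ≤ killedArOne θ X n ω ↔ ω ∈ persistenceEvent θ X n := by
  by_cases h : ω ∈ persistenceEvent θ X n
  · simp only [killedArOne_of_mem h, arOne_nonneg_of_mem h, h]
  · simp [killedArOne, h]

theorem measurable_arOne {m : MeasurableSpace Ω} (θ : ℝ) {X : ℕ → Ω → ℝ} (n : ℕ)
    (hX : ∀ i < n, Measurable[m] (X i)) : Measurable[m] (arOne θ X n) := by
  induction n with
  | zero => exact measurable_const
  | succ n ih =>
    exact ((ih fun i hi => hX i (by omega)).const_mul θ).add (hX n (by omega))

theorem measurableSet_persistenceEvent {m : MeasurableSpace Ω} (θ : ℝ) {X : ℕ → Ω → ℝ} (n : ℕ)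
    (hX : ∀ i < n, Measurable[m] (X i)) : MeasurableSet[m] (persistenceEvent θ X n) := by
  induction n with
  | zero => rw [persistenceEvent_zero]; exact MeasurableSet.univ
  | succ n ih =>
    rw [persistenceEvent_succ]
    exact (ih fun i hi => hX i (by omega)).inter
      (measurableSet_le measurable_const (measurable_arOne θ (n + 1) hX))

theorem measurable_killedArOne {m : MeasurableSpace Ω} (θ : ℝ) {X : ℕ → Ω → ℝ} (n : ℕ)
    (hX : ∀ i < n, Measurable[m] (X i)) : Measurable[m] (killedArOne θ X n) :=
  open Classical in
  Measurable.piecewise (measurableSet_persistenceEvent θ n hX) (measurable_arOne θ n hX)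
    measurable_const

variable [MeasurableSpace Ω] {P : Measure Ω} {θ : ℝ} {X : ℕ → Ω → ℝ}

theorem map_uniform_apply {Y : Ω → ℝ} (hY : Measurable Y)
    (hunif : pdf.IsUniform Y (Set.Icc (-1 : ℝ) 1) P volume) {S : Set ℝ} (hS : MeasurableSet S) :
    P.map Y S = volume (Set.Icc (-1 : ℝ) 1 ∩ S) / 2 := by
  have hv : volume (Set.Icc (-1 : ℝ) 1) = 2 := by
    rw [Real.volume_Icc]
    norm_num
  rw [Measure.map_apply hY hS, hunif.measure_preimage (by simp [hv]) (by simp [hv]) hS, hv]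

/-- The killed sequence at time `n` is measurable with respect to the innovations of index below
`n`. -/
theorem indepFun_killedArOne (hX : ∀ n, Measurable (X n)) (hind : iIndepFun X P) (n : ℕ) :
    IndepFun (killedArOne θ X n) (X n) P := by
  have h := indep_iSup_of_disjoint (fun i => (hX i).comap_le) hind.iIndep
    (S := Set.Iio n) (T := {n}) (by simp)
  refine indep_of_indep_of_le_left (indep_of_indep_of_le_right h ?_) ?_
  · exact le_iSup₂_of_le n (Set.mem_singleton n) le_rfl
  · refine Measurable.comap_le (measurable_killedArOne θ n fun i hi => ?_)
    exact Measurable.mono (comap_measurable (X i))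
      (le_iSup₂_of_le (f := fun i (_ : i ∈ Set.Iio n) => MeasurableSpace.comap (X i) _) i hi le_rfl)
      le_rfl

variable [IsProbabilityMeasure P]

/-- Killing encodes the whole past in one real variable, whose sign detects persistence; the formula
is then Fubini for a product law. -/
theorem measure_persistenceEvent_inter_succ (hX : ∀ n, Measurable (X n)) (hind : iIndepFun X P)
    (n : ℕ) {B : Set ℝ} (hB : MeasurableSet B) :
    P (persistenceEvent θ X n ∩ arOne θ X (n + 1) ⁻¹' B) =
      ∫⁻ z, P.map (X n) {x | 0 ≤ z ∧ θ * z + x ∈ B} ∂P.map (killedArOne θ X n) := by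
  have hZ : Measurable (killedArOne θ X n) := measurable_killedArOne θ n fun i _ => hX i
  have hmeas2 : MeasurableSet {p : ℝ × ℝ | 0 ≤ p.1 ∧ θ * p.1 + p.2 ∈ B} :=
    (measurableSet_le measurable_const measurable_fst).inter
      (((measurable_fst.const_mul θ).add measurable_snd) hB)
  have := Measure.isProbabilityMeasure_map (μ := P) (hX n).aemeasurable
  have h := (indepFun_iff_map_prod_eq_prod_map_map hZ.aemeasurable (hX n).aemeasurable).1
    (indepFun_killedArOne (θ := θ) hX hind n)
  have h1 := Measure.prod_apply (μ := P.map (killedArOne θ X n)) (ν := P.map (X n)) hmeas2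
  rw [← h, Measure.map_apply (hZ.prodMk (hX n)) hmeas2] at h1
  refine Eq.trans ?_ h1
  congr 1
  ext ω
  simp only [Set.mem_inter_iff, Set.mem_preimage, Set.mem_ofPred_eq, killedArOne_nonneg_iff]
  exact and_congr_right fun hω => by rw [killedArOne_of_mem hω, arOne]

theorem measure_persistenceEvent_inter (hθ : 2 ≤ θ) (hX : ∀ n, Measurable (X n))
    (hind : iIndepFun X P) (hunif : ∀ n, pdf.IsUniform (X n) (Set.Icc (-1 : ℝ) 1) P volume)
    (n : ℕ) {B : Set ℝ} (hB : MeasurableSet B) (hB1 : B ⊆ Set.Icc (-1) 1) :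
    P (persistenceEvent θ X n ∩ arOne θ X (n + 1) ⁻¹' B) =
      ∫⁻ t in B, ENNReal.ofReal (crossingDensity (1 / θ) n t / 2 ^ (n + 1)) := by
  have hθ0 : 0 < θ := by linarith
  induction n generalizing B with
  | zero =>
    have h := map_uniform_apply (hX 0) (hunif 0) hB
    rw [Measure.map_apply (hX 0) hB, Set.inter_eq_right.2 hB1] at h
    rw [persistenceEvent_zero, Set.univ_inter]
    have e : arOne θ X (0 + 1) = X 0 := by
      funext ω
      simp [arOne]
    rw [e, h]
    simp only [crossingDensity, zero_add, pow_one, lintegral_const, Measure.restrict_apply_univ]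
    rw [ENNReal.ofReal_div_of_pos two_pos, ENNReal.div_eq_inv_mul, ENNReal.div_eq_inv_mul]
    simp
  | succ n ih =>
    have hZ : Measurable (killedArOne θ X (n + 1)) :=
      measurable_killedArOne θ (n + 1) fun i _ => hX i
    have := Measure.isProbabilityMeasure_map (μ := P) (hX (n + 1)).aemeasurable
    have hd : Continuous fun t => crossingDensity (1 / θ) n t / 2 ^ (n + 1) :=
      (continuous_crossingDensity _ n).div_const _
    rw [measure_persistenceEvent_inter_succ hX hind (n + 1) hB,
      lintegral_uniform_transition hθ (fun S hS => map_uniform_apply (hX _) (hunif _) hS)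
        (ENNReal.measurable_ofReal.comp hd.measurable) ?_ hB hB1]
    · refine setLIntegral_congr_fun hB fun t ht => ?_
      have ht0 : 0 ≤ (1 + t) / θ := div_nonneg (by linarith [(hB1 ht).1]) hθ0.le
      simp only [Function.comp_def]
      rw [← ofReal_integral_eq_lintegral_ofReal hd.continuousOn.integrableOn_Icc,
        integral_Icc_eq_integral_Ioc, ← intervalIntegral.integral_of_le ht0,
        intervalIntegral.integral_div, crossingDensity, one_div_mul_eq_div,
        pow_succ _ (n + 1), ← div_div, ENNReal.ofReal_div_of_pos two_pos, ENNReal.ofReal_ofNat]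
      refine (ae_restrict_iff' measurableSet_Icc).2 (Filter.Eventually.of_forall fun z hz => ?_)
      exact div_nonneg (crossingDensity_nonneg (by positivity) n (by linarith [hz.1]))
        (by positivity)
    · intro S hS hSm
      rw [Measure.map_apply hZ hSm]
      refine Eq.trans ?_ (ih hSm (hS.trans (Set.Icc_subset_Icc_left (by norm_num))))
      congr 1
      ext ω
      rw [Set.mem_inter_iff, Set.mem_preimage, Set.mem_preimage]
      constructor
      · intro h
        have hω := killedArOne_nonneg_iff.1 (hS h).1
        rw [killedArOne_of_mem hω] at h
        rw [persistenceEvent_succ] at hω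
        exact ⟨hω.1, h⟩
      · rintro ⟨h1, h2⟩
        have hω : ω ∈ persistenceEvent θ X (n + 1) := by
          rw [persistenceEvent_succ]
          exact ⟨h1, (hS h2).1⟩
        rwa [killedArOne_of_mem hω]

theorem persistenceProb_zero : persistenceProb P θ X 0 = 1 := by
  simp [persistenceProb]

/-- After persistence, a first negative value lies almost surely in `[-1, 0)`, since `θ Y_n ≥ 0` and
the innovation is at least `-1`. The loss is thus the density integrated over this interval. -/
theorem persistenceProb_succ (hθ : 2 ≤ θ) (hX : ∀ n, Measurable (X n))
    (hind : iIndepFun X P) (hunif : ∀ n, pdf.IsUniform (X n) (Set.Icc (-1 : ℝ) 1) P volume)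
    (n : ℕ) :
    persistenceProb P θ X (n + 1) = persistenceProb P θ X n -
      Polynomial.aeval (1 / θ) (primeParkingPoly (n + 1)) / (2 ^ (n + 1) * ((n + 1) ! : ℝ)) := by
  have hθ0 : 0 < θ := by linarith
  have hq : 1 / θ ≠ 1 := by
    rw [Ne, div_eq_one_iff_eq hθ0.ne']
    linarith
  have hm := measurable_arOne θ (n + 1) fun i _ => hX i
  have hsplit := measureReal_inter_add_sdiff (μ := P) (s := persistenceEvent θ X n)
    (t := arOne θ X (n + 1) ⁻¹' Set.Ici 0) (hm measurableSet_Ici)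
  have hneg : P.real (persistenceEvent θ X n \ arOne θ X (n + 1) ⁻¹' Set.Ici 0) =
      Polynomial.aeval (1 / θ) (primeParkingPoly (n + 1)) / (2 ^ (n + 1) * ((n + 1) ! : ℝ)) := by
    have hlow : ∀ᵐ ω ∂P, -1 ≤ X n ω := by
      have h := map_uniform_apply (hX n) (hunif n) (measurableSet_Iio (a := (-1 : ℝ)))
      have he : Set.Icc (-1 : ℝ) 1 ∩ Set.Iio (-1) = ∅ :=
        Set.eq_empty_of_forall_notMem fun x hx => absurd hx.1.1 (not_le.2 hx.2)
      rw [he, measure_empty, ENNReal.zero_div, Measure.map_apply (hX n) measurableSet_Iio] at h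
      rw [ae_iff]
      convert h using 2
      ext ω
      simp
    have hae : (persistenceEvent θ X n \ arOne θ X (n + 1) ⁻¹' Set.Ici 0 : Set Ω) =ᵐ[P]
        (persistenceEvent θ X n ∩ arOne θ X (n + 1) ⁻¹' Set.Ico (-1) 0 : Set Ω) := by
      filter_upwards [hlow] with ω hω
      apply propext
      refine and_congr_right fun h => ?_
      have h0 := mul_nonneg hθ0.le (arOne_nonneg_of_mem h)
      have h1 : -1 ≤ arOne θ X (n + 1) ω := by
        rw [arOne]
        linarith
      simp [Set.mem_preimage, h1]
    have hd : Continuous fun t => crossingDensity (1 / θ) n t / 2 ^ (n + 1) :=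
      (continuous_crossingDensity _ n).div_const _
    have hnn : ∀ t ∈ Set.Ioc (-1 : ℝ) 0, 0 ≤ crossingDensity (1 / θ) n t / 2 ^ (n + 1) :=
      fun t ht => div_nonneg (crossingDensity_nonneg (by positivity) n ht.1.le) (by positivity)
    rw [Measure.real, measure_congr hae, measure_persistenceEvent_inter hθ hX hind hunif n
      measurableSet_Ico (Set.Ico_subset_Icc_self.trans (Set.Icc_subset_Icc_right zero_le_one)),
      setLIntegral_congr Ico_ae_eq_Ioc, ← ofReal_integral_eq_lintegral_ofReal
        (hd.integrableOn_Ioc) ((ae_restrict_iff' measurableSet_Ioc).2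
          (Filter.Eventually.of_forall hnn)), ENNReal.toReal_ofReal
        (setIntegral_nonneg measurableSet_Ioc hnn),
      ← intervalIntegral.integral_of_le (by norm_num), intervalIntegral.integral_div,
      integral_crossingDensity hq, div_div, mul_comm]
  have hpos : P.real (persistenceEvent θ X n ∩ arOne θ X (n + 1) ⁻¹' Set.Ici 0) =
      persistenceProb P θ X (n + 1) :=
    congrArg P.real (persistenceEvent_succ θ X n).symm
  rw [hpos, hneg] at hsplit
  exact eq_sub_of_add_eq hsplit

theorem persistenceProb_eq_aeval (hθ : 2 ≤ θ) (hX : ∀ n, Measurable (X n))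
    (hind : iIndepFun X P) (hunif : ∀ n, pdf.IsUniform (X n) (Set.Icc (-1 : ℝ) 1) P volume)
    (n : ℕ) :
    persistenceProb P θ X n =
      Polynomial.aeval (1 / θ) (persistencePoly n) / (2 ^ n * (n ! : ℝ)) := by
  induction n with
  | zero => simp [persistenceProb_zero, persistencePoly]
  | succ n ih => rw [persistenceProb_succ hθ hX hind hunif, ih, aeval_persistencePoly_succ]

end Autoregression

end

theorem corollary2 :
    (∀ n : ℕ, 1 ≤ n → ∃ J : ℤ[X], toRatFun J = mallowsRiordan n) ∧
    ∃ Jhat : ℕ → ℤ[X],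
      egf (fun n => toRatFun (Jhat (n + 1))) =
          (1 - 2 * (PowerSeries.X : RatFun⟦X⟧))⁻¹ * (egf fun n => mallowsRiordan (n + 1))⁻¹ ∧
      Jhat 1 = 1 ∧
      (∀ n : ℕ, 1 ≤ n →
        (Jhat (n + 1)).natDegree = n * (n - 1) / 2 ∧
        (Jhat (n + 1)).coeff 0 = 2 ^ (n - 1) * (n ! : ℤ) ∧
        ∀ k : ℕ, 1 ≤ k → k ≤ n * (n - 1) / 2 → (Jhat (n + 1)).coeff k < 0) ∧
      ∀ (θ : ℝ), 2 ≤ θ →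
        ∀ {Ω : Type*} [MeasurableSpace Ω] (P : Measure Ω) [IsProbabilityMeasure P]
          (X : ℕ → Ω → ℝ), (∀ n, Measurable (X n)) → iIndepFun X P →
          (∀ n, pdf.IsUniform (X n) (Set.Icc (-1 : ℝ) 1) P volume) →
          ∀ n : ℕ, persistenceProb P θ X n =
            Polynomial.aeval (1 / θ) (Jhat (n + 1)) / (2 ^ n * (n ! : ℝ)) := by
  -- The shift accounts for the index of `Ĵ_{n+1}`; the value at index 0 plays no role.
  refine ⟨fun n hn => ?_, fun n => persistencePoly (n - 1), egf_persistencePoly, ?_, ?_, ?_⟩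
  · obtain ⟨m, rfl⟩ := Nat.exists_eq_add_of_le' hn
    exact exists_toRatFun_eq_mallowsRiordan m
  · exact persistencePoly.eq_1
  · intro n hn
    obtain ⟨m, rfl⟩ := Nat.exists_eq_add_of_le' hn
    exact ⟨persistencePoly_natDegree _, persistencePoly_coeff_zero m,
      fun k h1 h2 => persistencePoly_coeff_neg m k h1 h2⟩
  · intro θ hθ Ω _ P _ X hX hind hunif n
    exact persistenceProb_eq_aeval hθ hX hind hunif n
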